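/- Let $P=(V,\le)$ be a poset. - $P$ is an *interval order* if it is isomorphic to a set of nonempty intervals (order-convex subsets) of some chain $C$, where intervals are ordered by $I<J$ if and only if $x<y$ for all $x\in I$ and $y\in J$. - A *module* of $P$ is a subset $A\subseteq V$ such that $(x\le a\Leftrightarrow x\le a')$ and $(a\le x\Leftrightarrow a'\le x)$ for all $a,a'\in A$ and all $x\in V\setminus A$. $P$ is *prime* if its only modules are $\varnothing$, the singletons and $V$. - $P$ is *scattered* if the chain $\mathbb{Q}$ of rational numbers does not order-embed into $P$. **Theorem.** Every prime interval order with no infinite antichain is at most countable and scattered. -/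

import Mathlib

universe u v

namespace IntervalOrders

/-- The set `Int(C)` of nonempty intervals of a chain `C`. An interval is an arbitrary
order-convex subset; it need not have endpoints. -/
@[ext]
structure ChainInterval (C : Type v) [LinearOrder C] where
  carrier : Set C
  nonempty : carrier.Nonempty
  ordConnected : carrier.OrdConnected

/-- `I` lies entirely before `J`: every element of `I` is strictly below every element of `J`. -/
def ChainInterval.Before {C : Type v} [LinearOrder C] (I J : ChainInterval C) : Prop :=
  ∀ x ∈ I.carrier, ∀ y ∈ J.carrier, x < y

theorem ChainInterval.Before.trans {C : Type v} [LinearOrder C] {I J K : ChainInterval C}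
    (h₁ : I.Before J) (h₂ : J.Before K) : I.Before K := by
  intro x hx z hz
  obtain ⟨y, hy⟩ := J.nonempty
  exact (h₁ x hx y hy).trans (h₂ y hy z hz)

theorem ChainInterval.Before.irrefl {C : Type v} [LinearOrder C] (I : ChainInterval C) :
    ¬ I.Before I := by
  intro h
  obtain ⟨x, hx⟩ := I.nonempty
  exact lt_irrefl x (h x hx x hx)

/-- The order on the nonempty intervals of a chain, whose strict part is `Before`
(see `ChainInterval.lt_iff_before`). -/
instance {C : Type v} [LinearOrder C] : PartialOrder (ChainInterval C) where
  le I J := I = J ∨ I.Before J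
  le_refl _ := Or.inl rfl
  le_trans I J K h₁ h₂ := by
    rcases h₁ with rfl | h₁
    · exact h₂
    · rcases h₂ with rfl | h₂
      · exact Or.inr h₁
      · exact Or.inr (h₁.trans h₂)
  le_antisymm I J h₁ h₂ := by
    rcases h₁ with h | h₁
    · exact h
    · rcases h₂ with h | h₂
      · exact h.symm
      · exact absurd (h₁.trans h₂) (ChainInterval.Before.irrefl I)

theorem ChainInterval.le_iff {C : Type v} [LinearOrder C] {I J : ChainInterval C} :
    I ≤ J ↔ I = J ∨ I.Before J := Iff.rfl

theorem ChainInterval.lt_iff_before {C : Type v} [LinearOrder C] {I J : ChainInterval C} :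
    I < J ↔ I.Before J := by
  rw [lt_iff_le_and_ne, ChainInterval.le_iff]
  constructor
  · rintro ⟨h | h, hne⟩
    · exact absurd h hne
    · exact h
  · intro h
    refine ⟨Or.inr h, ?_⟩
    rintro rfl
    exact ChainInterval.Before.irrefl I h

/-- A poset is an interval order if it is isomorphic to a set of nonempty intervals of some
chain. The chain may live in any universe `v`. -/
def IsIntervalOrder (P : Type u) [PartialOrder P] : Prop :=
  ∃ (C : Type v) (_ : LinearOrder C) (𝓙 : Set (ChainInterval C)), Nonempty (P ≃o 𝓙)

/-- Modules of a binary relational structure `(V, ρ)`. -/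
def IsModule {V : Type u} (ρ : V → V → Prop) (A : Set V) : Prop :=
  ∀ a ∈ A, ∀ a' ∈ A, ∀ x ∉ A, (ρ x a ↔ ρ x a') ∧ (ρ a x ↔ ρ a' x)

/-- The trivial modules: the empty set, the singletons and the whole set. -/
def IsTrivialModule {V : Type u} (A : Set V) : Prop :=
  A = ∅ ∨ (∃ x, A = {x}) ∨ A = Set.univ

/-- A poset is prime if all modules of the structure `(P, ≤)` are trivial. -/
def IsPrimePoset (P : Type u) [PartialOrder P] : Prop :=
  ∀ A : Set P, IsModule (fun x y : P => x ≤ y) A → IsTrivialModule A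

def NoInfiniteAntichain (P : Type u) [PartialOrder P] : Prop :=
  ∀ A : Set P, IsAntichain (· ≤ ·) A → A.Finite

/-- A poset is scattered if it does not embed the chain of rational numbers. -/
def IsScattered (P : Type u) [PartialOrder P] : Prop :=
  IsEmpty (ℚ ↪o P)

end IntervalOrders

namespace IntervalOrders

/-! For `u < v` in an interval order the elements spanning the pair form an antichain, hence a
finite set, while primality forces nontrivial proper subsets to be split from outside. A copy of ℚ
would then yield ever larger spanning antichains (`exists_spanning_ssubset`). A chain of uncountable
cofinality would yield a nontrivial module near its top, because finitely many exceptional elements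
can always be passed (`exists_countable_cofinal`). With cofinality and, by duality, coinitiality
countable for every chain, an uncountable chain would contain ℚ. So all chains are countable, and
finiteness of antichains passes this to the whole poset. -/

/-- The forbidden pattern of interval orders: there is no induced `2 + 2`. -/
def IsTwoPlusTwoFree (P : Type u) [PartialOrder P] : Prop :=
  ∀ a b c d : P, a < b → c < d → a < d ∨ c < b

theorem IsIntervalOrder.isTwoPlusTwoFree {P : Type u} [PartialOrder P]
    (h : IsIntervalOrder.{u, v} P) : IsTwoPlusTwoFree P := by
  obtain ⟨C, _, 𝓙, ⟨e⟩⟩ := h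
  have key : ∀ a b : P, a < b ↔ (e a).1.Before (e b).1 := fun a b => by
    rw [← ChainInterval.lt_iff_before, Subtype.coe_lt_coe, e.lt_iff_lt]
  intro a b c d hab hcd
  rw [key] at hab hcd ⊢
  rw [key]
  by_contra! hcon
  obtain ⟨had, hcb⟩ := hcon
  simp only [ChainInterval.Before, not_forall, not_lt] at had
  obtain ⟨x, hx, y, hy, hyx⟩ := had
  exact hcb fun z hz w hw => (hcd z hz y hy).trans_le (hyx.trans (hab x hx w hw).le)

theorem IsTwoPlusTwoFree.dual {P : Type u} [PartialOrder P] (h : IsTwoPlusTwoFree P) :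
    IsTwoPlusTwoFree Pᵒᵈ :=
  fun a b c d hab hcd => (h (OrderDual.ofDual d) (OrderDual.ofDual c) (OrderDual.ofDual b)
    (OrderDual.ofDual a) hcd hab)

theorem IsPrimePoset.dual {P : Type u} [PartialOrder P] (h : IsPrimePoset P) :
    IsPrimePoset Pᵒᵈ :=
  fun A hA => h (OrderDual.toDual ⁻¹' A) fun a ha a' ha' x hx => (hA a ha a' ha' x hx).symm

theorem NoInfiniteAntichain.dual {P : Type u} [PartialOrder P] (h : NoInfiniteAntichain P) :
    NoInfiniteAntichain Pᵒᵈ :=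
  fun A hA => h (OrderDual.toDual ⁻¹' A) fun _ ha _ hb hab => hA hb ha hab.symm

/-- In a prime poset, a set that is not trivial is split by some outside element. -/
theorem IsPrimePoset.exists_splitting {P : Type u} [PartialOrder P] (h : IsPrimePoset P)
    {A : Set P} {p q r : P} (hp : p ∈ A) (hq : q ∈ A) (hpq : p ≠ q) (hr : r ∉ A) :
    ∃ a ∈ A, ∃ a' ∈ A, ∃ x ∉ A, (x ≤ a ∧ ¬ x ≤ a') ∨ (a ≤ x ∧ ¬ a' ≤ x) := by
  by_contra! hcon
  have hA : IsModule (fun x y : P => x ≤ y) A := fun a ha a' ha' x hx =>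
    ⟨⟨(hcon a ha a' ha' x hx).1, (hcon a' ha' a ha x hx).1⟩,
      ⟨(hcon a ha a' ha' x hx).2, (hcon a' ha' a ha x hx).2⟩⟩
  rcases h A hA with rfl | ⟨y, rfl⟩ | rfl
  · exact hp
  · exact hpq (hp.trans hq.symm)
  · exact hr trivial

/-! ### Spanning antichains and scatteredness -/

/-- The elements that neither lie below `v` nor above `u`. In an interval order with `u < v`,
these are the intervals reaching from `u` to `v`. -/
def spanning {P : Type u} [PartialOrder P] (u v : P) : Set P :=
  {d | ¬ d < v ∧ ¬ u < d}

theorem spanning_subset_spanning {P : Type u} [PartialOrder P] {u v u' v' : P}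
    (hu : u ≤ u') (hv : v' ≤ v) : spanning u v ⊆ spanning u' v' :=
  fun _ hd => ⟨fun h => hd.1 (h.trans_le hv), fun h => hd.2 (hu.trans_lt h)⟩

theorem IsTwoPlusTwoFree.isAntichain_spanning {P : Type u} [PartialOrder P]
    (h : IsTwoPlusTwoFree P) {u v : P} (huv : u < v) : IsAntichain (· ≤ ·) (spanning u v) := by
  intro x hx y hy hxy hle
  rcases h x y u v (lt_of_le_of_ne hle hxy) huv with h' | h'
  · exact hx.1 h'
  · exact hy.2 h'

/-- The convex hull of the image of `(a, b)` is not a module, so an outside `x` splits it. This `x`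
is comparable to an end of the pair, so it does not span `f a`, `f b`; being outside the hull and
splitting it, `x` spans a pair nested inside. -/
theorem exists_spanning_ssubset {P : Type u} [PartialOrder P] (hprime : IsPrimePoset P)
    (f : ℚ ↪o P) {a b : ℚ} (hab : a < b) :
    ∃ a' b' : ℚ, a' < b' ∧ spanning (f a) (f b) ⊂ spanning (f a') (f b') := by
  let M : Set P := {p | ∃ r ∈ Set.Ioo a b, ∃ s ∈ Set.Ioo a b, f r ≤ p ∧ p ≤ f s}
  have hM : ∀ r ∈ Set.Ioo a b, f r ∈ M := fun r hr => ⟨r, hr, r, hr, le_rfl, le_rfl⟩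
  obtain ⟨c, hac, hcb⟩ := exists_between hab
  obtain ⟨d, hcd, hdb⟩ := exists_between hcb
  have haM : f a ∉ M := fun ⟨r, hr, _, _, hra, _⟩ => (f.le_iff_le.1 hra).not_gt hr.1
  obtain ⟨m, ⟨r₁, hr₁, s₁, hs₁, hrm₁, hms₁⟩, m', ⟨r₂, hr₂, s₂, hs₂, hrm₂, hms₂⟩, x, hx, hsplit⟩ :=
    hprime.exists_splitting (hM c ⟨hac, hcb⟩) (hM d ⟨hac.trans hcd, hdb⟩)
      (f.injective.ne hcd.ne) haM
  rcases hsplit with ⟨hxm, hxm'⟩ | ⟨hmx, hmx'⟩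
  · obtain ⟨t, hat, htr⟩ := exists_between hr₂.1
    have ht : ¬ f t ≤ x := fun h =>
      hx ⟨t, ⟨hat, htr.trans hr₂.2⟩, s₁, hs₁, h, hxm.trans hms₁⟩
    refine ⟨t, r₂, htr, (spanning_subset_spanning (f.monotone hat.le)
      (f.monotone hr₂.2.le)).ssubset_of_mem_notMem (a := x) ?_ ?_⟩
    · exact ⟨fun h => hxm' (h.le.trans hrm₂), fun h => ht h.le⟩
    · exact fun h => h.1 ((hxm.trans hms₁).trans_lt (f.lt_iff_lt.2 hs₁.2))
  · obtain ⟨t, hst, htb⟩ := exists_between hs₂.2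
    have ht : ¬ x ≤ f t := fun h =>
      hx ⟨r₁, hr₁, t, ⟨hs₂.1.trans hst, htb⟩, hrm₁.trans hmx, h⟩
    refine ⟨s₂, t, hst, (spanning_subset_spanning (f.monotone hs₂.1.le)
      (f.monotone htb.le)).ssubset_of_mem_notMem (a := x) ?_ ?_⟩
    · exact ⟨fun h => ht h.le, fun h => hmx' (hms₂.trans h.le)⟩
    · exact fun h => h.2 ((f.lt_iff_lt.2 hr₁.1).trans_le (hrm₁.trans hmx))

theorem IsPrimePoset.isScattered {P : Type u} [PartialOrder P] (hprime : IsPrimePoset P)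
    (hfree : IsTwoPlusTwoFree P) (hanti : NoInfiniteAntichain P) : IsScattered P := by
  refine ⟨fun f => ?_⟩
  let S : Type := {q : ℚ × ℚ // q.1 < q.2}
  let E : S → Set P := fun q => spanning (f q.1.1) (f q.1.2)
  have step : ∀ q : S, ∃ q' : S, E q ⊂ E q' := fun q => by
    obtain ⟨a, b, hab, h⟩ := exists_spanning_ssubset hprime f q.2
    exact ⟨⟨(a, b), hab⟩, h⟩
  choose g hg using step
  let F : ℕ → Set P := fun n => E (g^[n] ⟨(0, 1), zero_lt_one⟩)
  have hF : StrictMono F := strictMono_nat_of_lt_succ fun n => by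
    simp only [F, Function.iterate_succ_apply']
    exact hg _
  have hU : (⋃ n, F n).Finite := by
    refine hanti _ fun x hx y hy hxy => ?_
    obtain ⟨i, hi⟩ := Set.mem_iUnion.1 hx
    obtain ⟨j, hj⟩ := Set.mem_iUnion.1 hy
    exact hfree.isAntichain_spanning (f.lt_iff_lt.2 (g^[max i j] ⟨(0, 1), zero_lt_one⟩).2)
      (hF.monotone (le_max_left i j) hi) (hF.monotone (le_max_right i j) hj) hxy
  exact Set.infinite_range_of_injective hF.injective
    (hU.finite_subsets.subset (Set.range_subset_iff.2 fun n => Set.subset_iUnion F n))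

/-! ### Cofinality of chains -/

/-- Every chain has countable cofinality. -/
theorem IsPrimePoset.exists_countable_cofinal {P : Type u} [PartialOrder P]
    (hprime : IsPrimePoset P) (hfree : IsTwoPlusTwoFree P) (hanti : NoInfiniteAntichain P)
    {L : Set P} (hL : IsChain (· ≤ ·) L) :
    ∃ S ⊆ L, S.Countable ∧ ∀ l ∈ L, ∃ s ∈ S, l ≤ s := by
  by_contra! hcon
  have bound : ∀ S ⊆ L, S.Countable → ∃ l ∈ L, ∀ s ∈ S, s < l := by
    intro S hS hSc
    obtain ⟨l, hl, h⟩ := hcon S hS hSc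
    refine ⟨l, hl, fun s hs => ?_⟩
    exact lt_of_le_not_ge ((hL.total hl (hS hs)).resolve_left (h s hs)) (h s hs)
  have succ : ∀ l ∈ L, ∃ l' ∈ L, l < l' := fun l hl => by
    obtain ⟨l', hl', h⟩ := bound {l} (Set.singleton_subset_iff.2 hl) (Set.countable_singleton l)
    exact ⟨l', hl', h l rfl⟩
  -- Elements of `L` may be chosen above witnesses for finitely many elements of `P`.
  have collect : ∀ (R : P → P → Prop) (A : Set P), A.Finite → (∀ d ∈ A, ∃ γ ∈ L, R d γ) →
      ∀ β ∈ L, ∃ g ∈ L, β < g ∧ ∀ d ∈ A, ∃ γ ∈ L, γ < g ∧ R d γ := by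
    intro R A hA hR β hβ
    choose! w hwL hwR using hR
    obtain ⟨g, hg, h⟩ := bound (insert β (w '' A))
      (Set.insert_subset hβ (Set.image_subset_iff.2 hwL)) ((hA.image w).insert β).countable
    exact ⟨g, hg, h β (Set.mem_insert _ _), fun d hd =>
      ⟨w d, hwL d hd, h _ (Set.mem_insert_of_mem _ (Set.mem_image_of_mem w hd)), hwR d hd⟩⟩
  -- Only finitely many elements spanning `β`, `β'` lie below some member of `L`. Taking `g` above a
  -- witness for each of them expels them all.
  have step : ∀ β ∈ L, ∃ g ∈ L, β < g ∧ ∀ d ∈ spanning β g, ∀ γ ∈ L, ¬ d < γ := by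
    intro β hβ
    obtain ⟨β', hβ', hlt⟩ := succ β hβ
    obtain ⟨g, hg, hβg, h⟩ := collect (fun d γ => d < γ)
      {d ∈ spanning β β' | ∃ γ ∈ L, d < γ}
      ((hanti _ (hfree.isAntichain_spanning hlt)).subset (Set.sep_subset _ _))
      (fun d hd => hd.2) β' hβ'
    refine ⟨g, hg, hlt.trans hβg, fun d hd γ hγ hdγ => ?_⟩
    obtain ⟨γ', -, hγ'g, hdγ'⟩ :=
      h d ⟨spanning_subset_spanning le_rfl hβg.le hd, γ, hγ, hdγ⟩
    exact hd.1 (hdγ'.trans hγ'g)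
  -- Elements eventually incomparable to `L`. Any two span a common pair far up in `L`, so `F` is a
  -- finite antichain, and `β₀` can lie past all its thresholds.
  let F : Set P := {p | ∃ γ ∈ L, ∀ δ ∈ L, γ ≤ δ → ¬ p < δ ∧ ¬ δ < p}
  have hF : F.Finite := by
    refine hanti F fun x ⟨γ, hγ, hx⟩ y ⟨γ', hγ', hy⟩ hxy => ?_
    obtain ⟨u, hu, huγ⟩ := bound {γ, γ'} (Set.pair_subset hγ hγ') (Set.toFinite _).countable
    obtain ⟨v, hv, huv⟩ := succ u hu
    have h₁ : γ < u := huγ γ (by simp)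
    have h₂ : γ' < u := huγ γ' (by simp)
    exact hfree.isAntichain_spanning huv
      ⟨(hx v hv (h₁.trans huv).le).1, (hx u hu h₁.le).2⟩
      ⟨(hy v hv (h₂.trans huv).le).1, (hy u hu h₂.le).2⟩ hxy
  obtain ⟨l₀, hl₀, -⟩ := bound ∅ (Set.empty_subset L) Set.countable_empty
  obtain ⟨β₀, hβ₀, -, hβ₀F⟩ := collect
    (fun p γ => ∀ δ ∈ L, γ ≤ δ → ¬ p < δ ∧ ¬ δ < p) F hF (fun _ h => h) l₀ hl₀
  choose g hgL hlt hg using step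
  let G : L → L := fun β => ⟨g β β.2, hgL β β.2⟩
  let β : ℕ → L := fun n => G^[n] ⟨β₀, hβ₀⟩
  have hβs : ∀ n, β (n + 1) = G (β n) := fun n => Function.iterate_succ_apply' G n _
  have hβlt : ∀ n, (β n : P) < β (n + 1) := fun n => by
    rw [hβs]
    exact hlt _ _
  -- Nothing splits `N`: an `x` splitting it from below would span some `β n`, `β (n + 1)` yet lie
  -- below a member of `L`; one splitting it from above would be in `F` yet lie above `β₀`.
  let N : Set P := {p | (∀ n, (β n : P) < p) ∧ ∃ γ ∈ L, p < γ}
  obtain ⟨l, hl, hβl⟩ := bound (Set.range fun n => (β n : P))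
    (Set.range_subset_iff.2 fun n => (β n).2) (Set.countable_range _)
  replace hβl : ∀ n, (β n : P) < l := fun n => hβl _ ⟨n, rfl⟩
  obtain ⟨l', hl', hll'⟩ := succ l hl
  obtain ⟨a, ⟨haβ, γ, hγ, haγ⟩, a', ⟨haβ', γ', hγ', haγ'⟩, x, hx, hsplit⟩ :=
    hprime.exists_splitting (A := N) (p := l) (q := l') (r := β 0) ⟨hβl, l', hl', hll'⟩
      ⟨fun n => (hβl n).trans hll', succ l' hl'⟩ hll'.ne fun h => lt_irrefl _ (h.1 0)
  rcases hsplit with ⟨hxa, hxa'⟩ | ⟨hax, hax'⟩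
  · have hxγ : x < γ := hxa.trans_lt haγ
    obtain ⟨n, hn⟩ : ∃ n, ¬ (β n : P) < x := by
      by_contra! h
      exact hx ⟨h, γ, hγ, hxγ⟩
    have hspan : x ∈ spanning (β n : P) (β (n + 1)) :=
      ⟨fun h => hxa' (h.trans (haβ' _)).le, hn⟩
    rw [hβs] at hspan
    exact hg _ _ x hspan γ hγ hxγ
  · have hxL : ∀ δ ∈ L, ¬ x < δ := fun δ hδ h =>
      hx ⟨fun n => (haβ n).trans_le hax, δ, hδ, h⟩
    have hxF : x ∈ F := ⟨γ', hγ', fun δ hδ hle =>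
      ⟨hxL δ hδ, fun h => hax' (haγ'.le.trans (hle.trans h.le))⟩⟩
    obtain ⟨δ, _, hδ, h⟩ := hβ₀F x hxF
    exact (h β₀ hβ₀ hδ.le).2 ((haβ 0).trans_le hax)

/-! ### Countability -/

/-- An uncountable chain, all of whose subsets have countable cofinality and coinitiality,
embeds the chain of rational numbers. -/
theorem nonempty_rat_orderEmbedding {C : Type u} [LinearOrder C] [Uncountable C]
    (hcof : ∀ S : Set C, ∃ T ⊆ S, T.Countable ∧ ∀ s ∈ S, ∃ t ∈ T, s ≤ t)
    (hcoi : ∀ S : Set C, ∃ T ⊆ S, T.Countable ∧ ∀ s ∈ S, ∃ t ∈ T, t ≤ s) :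
    Nonempty (ℚ ↪o C) := by
  -- Condensation: points with countably many points between them are identified. Classes are
  -- countable, so no two representatives are adjacent.
  let r : Setoid C :=
    { r := fun a b => (Set.uIcc a b).Countable
      iseqv :=
        { refl := fun a => by simp
          symm := fun h => by rwa [Set.uIcc_comm]
          trans := fun h₁ h₂ => (h₁.union h₂).mono Set.uIcc_subset_uIcc_union_uIcc } }
  have hclass : ∀ a, {b | r a b}.Countable := by
    intro a
    obtain ⟨T, hT, hTc, hTle⟩ := hcof {b | r a b}
    obtain ⟨S, hS, hSc, hSle⟩ := hcoi {b | r a b}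
    have : (⋃ s ∈ S, ⋃ t ∈ T, Set.Icc s t).Countable :=
      hSc.biUnion fun s hs => hTc.biUnion fun t ht =>
        Set.Countable.mono Set.Icc_subset_uIcc (r.trans (r.symm (hS hs)) (hT ht))
    refine this.mono fun b hb => ?_
    obtain ⟨t, ht, hbt⟩ := hTle b hb
    obtain ⟨s, hs, hsb⟩ := hSle b hb
    simp only [Set.mem_iUnion]
    exact ⟨s, hs, t, ht, hsb, hbt⟩
  let R : Set C := Set.range (Quotient.out : Quotient r → C)
  have hR : ∀ c, ∃ c' ∈ R, r c' c := fun c => ⟨_, ⟨⟦c⟧, rfl⟩, Quotient.mk_out c⟩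
  have hRinj : ∀ a ∈ R, ∀ b ∈ R, r a b → a = b := by
    rintro _ ⟨a, rfl⟩ _ ⟨b, rfl⟩ h
    rw [Quotient.out_equiv_out.1 h]
  have hdense : DenselyOrdered R := by
    refine ⟨fun a b hab => ?_⟩
    by_contra! hcon
    refine hab.ne (Subtype.ext (hRinj a a.2 b b.2 ?_))
    have hsub : Set.uIcc (a : C) b ⊆ {c | r a c} ∪ {c | r b c} := by
      rw [Set.uIcc_of_le (Subtype.coe_le_coe.2 hab.le)]
      rintro c ⟨hac, hcb⟩
      obtain ⟨c', hc', hcc'⟩ := hR c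
      rcases le_or_gt c' a with h | h
      · exact Or.inl (Set.Countable.mono (Set.uIcc_subset_uIcc_right
          (Set.Icc_subset_uIcc ⟨h, hac⟩)) hcc')
      · have hbc : (b : C) ≤ c' := hcon ⟨c', hc'⟩ h
        refine Or.inr (Set.Countable.mono (Set.uIcc_subset_uIcc_right ?_) hcc')
        exact Set.Icc_subset_uIcc' ⟨hcb, hbc⟩
    exact ((hclass a).union (hclass b)).mono hsub
  have hnontrivial : Nontrivial R := by
    by_contra hcon
    rw [not_nontrivial_iff_subsingleton] at hcon
    obtain ⟨c₀⟩ : Nonempty C := inferInstance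
    obtain ⟨c, hc, -⟩ := hR c₀
    refine Set.not_countable_univ ((hclass c).mono fun b _ => ?_)
    obtain ⟨b', hb', h⟩ := hR b
    have : (⟨b', hb'⟩ : R) = ⟨c, hc⟩ := Subsingleton.elim _ _
    rw [Subtype.mk.injEq] at this
    exact this ▸ h
  obtain ⟨f⟩ := Order.embedding_from_countable_to_dense ℚ R
  exact ⟨f.trans (OrderEmbedding.subtype _)⟩

/-- A poset with countable chains and finite antichains is countable. -/
theorem NoInfiniteAntichain.countable {P : Type u} [PartialOrder P]
    (hanti : NoInfiniteAntichain P)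
    (hchain : ∀ L : Set P, IsChain (· ≤ ·) L → L.Countable) : Countable P := by
  by_contra hP
  -- Antichains that leave uncountably many elements incomparable to all their members; each can be
  -- enlarged, without end.
  let S : Type u := {A : Set P // IsAntichain (· ≤ ·) A ∧
    ¬ {p | ∀ a ∈ A, ¬ a ≤ p ∧ ¬ p ≤ a}.Countable}
  have step : ∀ A : S, ∃ B : S, A.1 ⊂ B.1 := by
    rintro ⟨A, hA, hAc⟩
    set N : Set P := {p | ∀ a ∈ A, ¬ a ≤ p ∧ ¬ p ≤ a} with hN
    obtain ⟨M, -, hMax⟩ := zorn_subset_nonempty {L | L ⊆ N ∧ IsChain (· ≤ ·) L}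
      (fun c hc hcc _ => ⟨⋃₀ c, ⟨Set.sUnion_subset fun s hs => (hc hs).1,
        by
          intro x ⟨s, hs, hxs⟩ y ⟨t, ht, hyt⟩ hxy
          rcases hcc.total hs ht with h | h
          · exact (hc ht).2 (h hxs) hyt hxy
          · exact (hc hs).2 hxs (h hyt) hxy⟩,
        fun s hs => Set.subset_sUnion_of_mem hs⟩) ∅ ⟨Set.empty_subset N, by simp [IsChain]⟩
    have hM := hMax.prop
    -- Maximality of the chain `M`. As `M` is countable, one of its elements must be incomparable to
    -- uncountably many elements of `N`.
    have hcover : N ⊆ M ∪ ⋃ c ∈ M, {p ∈ N | ¬ c ≤ p ∧ ¬ p ≤ c} := by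
      intro p hp
      by_contra hcon
      simp only [Set.mem_union, Set.mem_iUnion, not_or, not_exists] at hcon
      refine hcon.1 (hMax.le_of_ge (y := insert p M) ⟨Set.insert_subset hp hM.1,
        hM.2.insert fun b hb _ => ?_⟩ (Set.subset_insert p M) (Set.mem_insert p M))
      by_contra! h
      exact hcon.2 b hb ⟨hp, h.2, h.1⟩
    obtain ⟨c, hc, hcN⟩ : ∃ c ∈ M, ¬ {p ∈ N | ¬ c ≤ p ∧ ¬ p ≤ c}.Countable := by
      by_contra! h
      exact hAc (((hchain M hM.2).union ((hchain M hM.2).biUnion h)).mono hcover)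
    have hcA := hM.1 hc
    refine ⟨⟨insert c A, hA.insert (fun b hb _ => (hcA b hb).1) (fun b hb _ => (hcA b hb).2),
      fun h => hcN (h.mono ?_)⟩, Set.ssubset_insert fun h => (hcA c h).1 le_rfl⟩
    rintro p ⟨hp, hcp⟩ a (rfl | ha)
    · exact hcp
    · exact hp a ha
  choose g hg using step
  let A₀ : S := ⟨∅, by simp [IsAntichain], by simpa [Set.countable_univ_iff] using hP⟩
  let F : ℕ → Set P := fun n => (g^[n] A₀).1
  have hF : StrictMono F := strictMono_nat_of_lt_succ fun n => by
    simp only [F, Function.iterate_succ_apply']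
    exact hg _
  have hU : (⋃ n, F n).Finite := by
    refine hanti _ fun x hx y hy hxy => ?_
    obtain ⟨i, hi⟩ := Set.mem_iUnion.1 hx
    obtain ⟨j, hj⟩ := Set.mem_iUnion.1 hy
    exact (g^[max i j] A₀).2.1 (hF.monotone (le_max_left i j) hi)
      (hF.monotone (le_max_right i j) hj) hxy
  exact Set.infinite_range_of_injective hF.injective
    (hU.finite_subsets.subset (Set.range_subset_iff.2 fun n => Set.subset_iUnion F n))

theorem IsPrimePoset.countable {P : Type u} [PartialOrder P] (hprime : IsPrimePoset P)
    (hfree : IsTwoPlusTwoFree P) (hanti : NoInfiniteAntichain P) : Countable P := by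
  classical
  refine hanti.countable fun L hL => ?_
  by_contra hLc
  have : Uncountable L := ⟨fun h => hLc (Set.countable_coe_iff.1 h)⟩
  let _ : LinearOrder L :=
    { (inferInstance : PartialOrder L) with
      le_total := fun a b => hL.total a.2 b.2
      toDecidableLE := Classical.decRel _ }
  have hsub : ∀ S : Set L, IsChain (· ≤ ·) (Subtype.val '' S) := fun S =>
    hL.mono (by rintro _ ⟨a, -, rfl⟩; exact a.2)
  have hcof : ∀ S : Set L, ∃ T ⊆ S, T.Countable ∧ ∀ s ∈ S, ∃ t ∈ T, s ≤ t := by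
    intro S
    obtain ⟨T, hT, hTc, h⟩ := hprime.exists_countable_cofinal hfree hanti (hsub S)
    refine ⟨Subtype.val ⁻¹' T, fun t ht => ?_, hTc.preimage Subtype.val_injective,
      fun s hs => ?_⟩
    · obtain ⟨t', ht', h'⟩ := hT ht
      rwa [← Subtype.ext h']
    · obtain ⟨t, ht, hst⟩ := h s ⟨s, hs, rfl⟩
      obtain ⟨t', -, rfl⟩ := hT ht
      exact ⟨t', ht, hst⟩
  have hcoi : ∀ S : Set L, ∃ T ⊆ S, T.Countable ∧ ∀ s ∈ S, ∃ t ∈ T, t ≤ s := by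
    intro S
    obtain ⟨T, hT, hTc, h⟩ := hprime.dual.exists_countable_cofinal hfree.dual hanti.dual
      (L := OrderDual.ofDual ⁻¹' (Subtype.val '' S)) (fun a ha b hb hab => (hsub S ha hb hab).symm)
    refine ⟨{s | OrderDual.toDual (s : P) ∈ T}, fun t ht => ?_,
      hTc.preimage (f := fun s : L => OrderDual.toDual (s : P)) Subtype.val_injective,
      fun s hs => ?_⟩
    · obtain ⟨t', ht', h'⟩ := hT ht
      rwa [← Subtype.ext h']
    · obtain ⟨t, ht, hst⟩ := h (OrderDual.toDual (s : P)) ⟨s, hs, rfl⟩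
      obtain ⟨t', -, h'⟩ := hT ht
      obtain rfl : OrderDual.toDual (t' : P) = t := h'
      exact ⟨t', ht, hst⟩
  obtain ⟨f⟩ := nonempty_rat_orderEmbedding hcof hcoi
  exact (hprime.isScattered hfree hanti).false (f.trans (OrderEmbedding.subtype _))

end IntervalOrders

theorem theorem1p4 (P : Type u) [PartialOrder P]
    (hprime : IntervalOrders.IsPrimePoset P)
    (hint : IntervalOrders.IsIntervalOrder.{u, v} P)
    (hanti : IntervalOrders.NoInfiniteAntichain P) :
    Countable P ∧ IntervalOrders.IsScattered P :=
  ⟨hprime.countable hint.isTwoPlusTwoFree hanti,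
    hprime.isScattered hint.isTwoPlusTwoFree hanti⟩
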